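/- For an algebraic number $\alpha\in\overline{\mathbb{Q}}\subset\mathbb{C}$ let $f(x)=a_n\prod_{i=1}^n(x-\alpha_i)\in\mathbb{Z}[x]$ be its minimal polynomial over $\mathbb{Z}$ (the primitive integer polynomial, unique up to sign, that is irreducible and vanishes at $\alpha$), and let $$M(\alpha)=\exp\left(\int_0^1\log|f(e^{2\pi i t})|\,dt\right)=|a_n|\prod_{i=1}^n\max\{1,|\alpha_i|\}$$ be its Mahler measure. Since $M(\alpha)$ is again an algebraic number, $M$ can be iterated; write $M^0(\alpha)=\alpha$ and $M^{n}(\alpha)=M(M^{n-1}(\alpha))$ for $n\ge 1$. The number $\alpha$ is called wandering under iteration of $M$ if its forward orbit $\{M^n(\alpha): n\ge 0\}$ is infinite. Theorem. Let $K/\mathbb{Q}$ be a field extension of degree five. Then there is an algebraic unit $u\in\mathcal{O}_K^\times$ which is wandering under iteration of $M$. (Here $K$ is regarded as a subfield of $\mathbb{C}$ via an embedding $\varphi\colon K\to\mathbb{C}$; one and the same $u$ has the property that $\varphi(u)$ is wandering for every embedding $\varphi$.) -/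

import Mathlib

open Polynomial

/-- The minimal polynomial over `ℤ` of an algebraic number `α`: the primitive integer polynomial
obtained from the monic minimal polynomial over `ℚ` by clearing denominators and dividing by the
content. It is determined up to sign, which does not affect the Mahler measure. -/
noncomputable def intMinpoly (α : ℂ) : ℤ[X] :=
  (IsLocalization.integerNormalization (nonZeroDivisors ℤ) (minpoly ℚ α)).primPart

/-- The Mahler measure `M(α)` of an algebraic number `α`: the Mahler measure of its minimal
polynomial over `ℤ`. It is regarded as a complex number, so that it can be iterated; by
`isAlgebraic_mahlerM` below, all iterates of `M` at an algebraic number are algebraic. -/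
noncomputable def mahlerM (α : ℂ) : ℂ :=
  (((intMinpoly α).map (Int.castRingHom ℂ)).mahlerMeasure : ℝ)

/-- `α` wanders under iteration of the Mahler measure: the forward orbit
`{M^n(α) : n ≥ 0}` is infinite. -/
def IsWandering (α : ℂ) : Prop :=
  (Set.range fun n : ℕ => mahlerM^[n] α).Infinite

theorem intMinpoly_isPrimitive (α : ℂ) : (intMinpoly α).IsPrimitive :=
  isPrimitive_primPart _

/-- Over `ℚ`, `intMinpoly α` is a nonzero constant multiple of the minimal polynomial of `α`. -/
theorem intMinpoly_associated {α : ℂ} (hα : IsAlgebraic ℚ α) :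
    Associated ((intMinpoly α).map (Int.castRingHom ℚ)) (minpoly ℚ α) := by
  have h0 : minpoly ℚ α ≠ 0 := minpoly.ne_zero hα.isIntegral
  obtain ⟨b, hb, hb'⟩ := IsLocalization.integerNormalization_spec
    (nonZeroDivisors ℤ) (minpoly ℚ α)
  have hb0 : (b : ℚ) ≠ 0 := by exact_mod_cast nonZeroDivisors.ne_zero hb
  set q := IsLocalization.integerNormalization (nonZeroDivisors ℤ) (minpoly ℚ α) with hq
  have hb2 : q.map (Int.castRingHom ℚ) = C (b : ℚ) * minpoly ℚ α := by
    have : q.map (Int.castRingHom ℚ) = b • minpoly ℚ α := hb'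
    rw [this, ← smul_eq_C_mul, Int.cast_smul_eq_zsmul]
  have hq0 : q ≠ 0 := by
    intro h
    rw [h, Polynomial.map_zero] at hb2
    exact mul_ne_zero (C_ne_zero.mpr hb0) h0 hb2.symm
  have hc : (q.content : ℚ) ≠ 0 := by exact_mod_cast (content_eq_zero_iff.not.mpr hq0)
  have h1 : C (q.content : ℚ) * (intMinpoly α).map (Int.castRingHom ℚ) =
      C (b : ℚ) * minpoly ℚ α := by
    rw [← hb2]
    conv_rhs => rw [q.eq_C_content_mul_primPart]
    simp [intMinpoly, ← hq]
  have u1 : IsUnit (C (q.content : ℚ)) := isUnit_C.mpr (isUnit_iff_ne_zero.mpr hc)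
  have u2 : IsUnit (C (b : ℚ)) := isUnit_C.mpr (isUnit_iff_ne_zero.mpr hb0)
  rw [← associated_isUnit_mul_left_iff u1, h1, associated_isUnit_mul_left_iff u2]
  exact Associated.refl _

/-- The Mahler measure maps algebraic numbers to algebraic numbers. -/
theorem isAlgebraic_mahlerM (α : ℂ) : IsAlgebraic ℚ (mahlerM α) := by
  have hne : intMinpoly α ≠ 0 := (intMinpoly_isPrimitive α).ne_zero
  have habs : ∀ z : ℂ, IsAlgebraic ℚ z → IsAlgebraic ℚ ((‖z‖ : ℝ) : ℂ) := by
    intro z hz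
    refine IsAlgebraic.of_pow (n := 2) two_pos ?_
    have : (((‖z‖ : ℝ) : ℂ)) ^ 2 = z * (starRingEnd ℂ) z := by
      rw [Complex.mul_conj, Complex.normSq_eq_norm_sq]; push_cast; rfl
    rw [this]
    exact hz.mul (hz.algHom (Complex.conjAe.toAlgHom.restrictScalars ℚ))
  rw [mahlerM, mahlerMeasure_eq_leadingCoeff_mul_prod_roots]
  rw [Complex.ofReal_mul]
  refine IsAlgebraic.mul (habs _ ?_) ?_
  · rw [leadingCoeff_map_of_injective (RingHom.injective_int _)]
    exact isAlgebraic_intCast (R := ℚ) _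
  · rw [← Complex.ofRealHom_eq_coe, map_multiset_prod, Multiset.map_map]
    refine Multiset.prod_induction (IsAlgebraic ℚ) _ (fun _ _ => IsAlgebraic.mul)
      isAlgebraic_one ?_
    intro x hx
    obtain ⟨z, hz, rfl⟩ := Multiset.mem_map.mp hx
    have hzalg : IsAlgebraic ℚ z := by
      have : IsAlgebraic ℤ z := ⟨intMinpoly α, hne, by
        have := (mem_roots'.mp hz).2
        rwa [IsRoot, eval_map, ← algebraMap_int_eq, ← aeval_def] at this⟩
      exact this.extendScalars (RingHom.injective_int (algebraMap ℤ ℚ))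
    simp only [Function.comp_apply, Complex.ofRealHom_eq_coe]
    rcases max_choice 1 ‖z‖ with h | h <;> rw [h]
    · simpa using isAlgebraic_one
    · exact habs z hzalg

/-! Dirichlet's unit theorem gives a unit with two large conjugates, of size about `e^(3t)`, and
three small ones, of size about `e^(-2t)`. The Galois group permutes the five conjugates
transitively, so it contains a 5-cycle. A power of this cycle carries one large conjugate to the
other, hence the conjugates label a pentagon rotated by the group, with the large ones on one side.
Let `β` be their product. It is real, and the first Mahler measure is `|β|`.

If some automorphism sends a side to a diagonal, the group is transitive on pairs and `β` has all
ten pair products as conjugates. Counting those above 1 gives `M(±β^N) = |β|^(2N)`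
(`IsConjFamily.mahlerM_pair_pow`), so the exponent doubles forever.

Otherwise the group preserves the pentagon, and the five side products again form a conjugate
family. The pattern "large on exactly one side" persists up to inversion
(`IsLargeOppositeTo.exists_opposite`), inversion does not change the Mahler measure of a unit, and
absolute values strictly increase (`IsPentagonal.mahlerM_and_norm_lt`). -/

/-! ### Units with prescribed archimedean sizes -/

section UnitApproximation

open NumberField NumberField.Units NumberField.Units.dirichletUnitTheorem NumberField.InfinitePlace

variable {K : Type*} [Field K] [NumberField K]

open scoped Classical in
/-- Every line in the logarithmic space stays within bounded distance of the unit lattice. -/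
theorem exists_unit_logEmbedding_near (v : logSpace K) :
    ∃ C : ℝ, ∀ t : ℝ, ∃ u : (𝓞 K)ˣ, ‖logEmbedding K (Additive.ofMul u) - t • v‖ ≤ C := by
  have hv : v ∈ Submodule.span ℝ (unitLattice K : Set (logSpace K)) := by
    rw [unitLattice_span_eq_top]; trivial
  induction hv using Submodule.span_induction with
  | mem x hx =>
    obtain ⟨y, -, rfl⟩ := hx
    refine ⟨‖logEmbedding K y‖, fun t => ⟨y.toMul ^ ⌊t⌋, ?_⟩⟩
    have h : logEmbedding K (Additive.ofMul (y.toMul ^ ⌊t⌋)) - t • logEmbedding K y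
        = (-Int.fract t) • logEmbedding K y := by
      rw [ofMul_zpow, ofMul_toMul, map_zsmul, ← Int.cast_smul_eq_zsmul ℝ, ← sub_smul]
      congr 1
      rw [Int.fract]; ring
    refine (congrArg norm h).le.trans ?_
    rw [norm_smul, norm_neg, Real.norm_of_nonneg (Int.fract_nonneg t)]
    exact mul_le_of_le_one_left (norm_nonneg _) (Int.fract_lt_one t).le
  | zero => exact ⟨0, fun t => ⟨1, by simp⟩⟩
  | add x y _ _ hx hy =>
    obtain ⟨C, hC⟩ := hx
    obtain ⟨D, hD⟩ := hy
    refine ⟨C + D, fun t => ?_⟩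
    obtain ⟨u, hu⟩ := hC t
    obtain ⟨u', hu'⟩ := hD t
    refine ⟨u * u', ?_⟩
    rw [ofMul_mul, map_add, smul_add, add_sub_add_comm]
    exact (norm_add_le _ _).trans (add_le_add hu hu')
  | smul a x _ hx =>
    obtain ⟨C, hC⟩ := hx
    refine ⟨C, fun t => ?_⟩
    obtain ⟨u, hu⟩ := hC (t * a)
    exact ⟨u, by rwa [smul_smul]⟩

/-- Any vector of trace zero is approximated in direction by the logarithms of a unit. -/
theorem exists_unit_log_near (v : InfinitePlace K → ℝ) (hv : ∑ w, (w.mult : ℝ) * v w = 0)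
    {ε : ℝ} (hε : 0 < ε) :
    ∃ u : (𝓞 K)ˣ, ∃ t : ℝ, 0 < t ∧ ∀ w : InfinitePlace K,
      |Real.log (w (u : K)) - t * v w| < ε * t := by
  classical
  obtain ⟨C, hC⟩ := exists_unit_logEmbedding_near (fun w : {w : InfinitePlace K // w ≠ w₀} =>
    (w.1.mult : ℝ) * v w.1)
  have hC0 : 0 ≤ C := (norm_nonneg _).trans (hC 0).choose_spec
  obtain ⟨n, hcard⟩ : ∃ n : ℝ, n = (Fintype.card (InfinitePlace K) : ℝ) := ⟨_, rfl⟩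
  have hn : 1 ≤ n := by
    rw [hcard]; exact_mod_cast Fintype.card_pos (α := InfinitePlace K)
  have key : ∀ t : ℝ, ∃ u : (𝓞 K)ˣ, ∀ w : InfinitePlace K,
      |Real.log (w (u : K)) - t * v w| ≤ n * C := by
    intro t
    obtain ⟨u, hu⟩ := hC t
    refine ⟨u, fun w => ?_⟩
    set d : InfinitePlace K → ℝ := fun w => (w.mult : ℝ) * (Real.log (w (u : K)) - t * v w)
    have hd : ∀ w, w ≠ w₀ → |d w| ≤ C := by
      intro w hw
      have := (norm_le_pi_norm _ ⟨w, hw⟩).trans hu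
      simp only [Pi.sub_apply, Pi.smul_apply, logEmbedding_component, smul_eq_mul,
        Real.norm_eq_abs] at this
      rwa [show d w = w.mult * Real.log (w (u : K)) - t * (w.mult * v w) by simp only [d]; ring]
    have hsum : ∑ w, d w = 0 := by
      simp_rw [d, mul_sub, Finset.sum_sub_distrib]
      rw [sum_mult_mul_log]
      have : ∀ w : InfinitePlace K, (w.mult : ℝ) * (t * v w) = t * (w.mult * v w) :=
        fun w => by ring
      simp [this, ← Finset.mul_sum, hv]
    have hmult : |Real.log (w (u : K)) - t * v w| ≤ |d w| := by
      simp only [d, abs_mul, Nat.abs_cast]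
      exact le_mul_of_one_le_left (abs_nonneg _) (by exact_mod_cast mult_pos)
    refine hmult.trans ?_
    by_cases hw : w = w₀
    -- The logarithmic embedding omits `w₀`; its coordinate is recovered from the vanishing sum, at
    -- the cost of the factor `n`.
    · rw [← Finset.add_sum_erase _ _ (Finset.mem_univ w)] at hsum
      rw [eq_neg_of_add_eq_zero_left hsum, abs_neg]
      refine (Finset.abs_sum_le_sum_abs _ _).trans ?_
      refine (Finset.sum_le_card_nsmul _ _ C fun x hx => hd x ?_).trans ?_
      · rw [← hw]; exact Finset.ne_of_mem_erase hx
      · rw [nsmul_eq_mul]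
        refine mul_le_mul_of_nonneg_right ?_ hC0
        rw [hcard]; exact_mod_cast Finset.card_le_univ _
    · exact (hd w hw).trans (le_mul_of_one_le_left hC0 hn)
  -- Chosen so that `ε * t = n * C + 1` exceeds the uniform error `n * C`.
  obtain ⟨u, hu⟩ := key ((n * C + 1) / ε)
  have hpos : 0 < n * C + 1 := by positivity
  refine ⟨u, (n * C + 1) / ε, by positivity, fun w => (hu w).trans_lt ?_⟩
  rw [mul_div_cancel₀ _ hε.ne']
  linarith

/-- A complex place accounts for two embeddings by itself; a totally real field has five places of
multiplicity one, any two of which will do. -/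
theorem exists_finset_infinitePlace_sum_mult_eq_two (hK : Module.finrank ℚ K = 5) :
    ∃ S : Finset (InfinitePlace K), ∑ w ∈ S, w.mult = 2 := by
  classical
  have hsum := sum_mult_eq (K := K)
  rw [hK] at hsum
  by_cases h : ∃ w : InfinitePlace K, w.IsComplex
  · obtain ⟨w, hw⟩ := h
    exact ⟨{w}, by simp [mult, not_isReal_iff_isComplex.mpr hw]⟩
  · push Not at h
    have h1 : ∀ w : InfinitePlace K, w.mult = 1 := fun w => by
      simp [mult, not_isComplex_iff_isReal.mp (h w)]
    simp only [h1, Finset.sum_const, smul_eq_mul, mul_one] at hsum ⊢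
    obtain ⟨S, -, hS⟩ := Finset.exists_subset_card_eq (s := (Finset.univ : Finset (InfinitePlace K)))
      (n := 2) (by omega)
    exact ⟨S, hS⟩

/-- A quintic field has a unit with two dominant conjugates, larger than the inverses of the
remaining conjugates, which lie inside the unit circle. -/
theorem exists_unit_two_dominant (hK : Module.finrank ℚ K = 5) :
    ∃ (u : (𝓞 K)ˣ) (a b : K →+* ℂ), a ≠ b ∧ 1 < ‖a (u : K)‖ ∧ 1 < ‖b (u : K)‖ ∧
      ∀ c : K →+* ℂ, c ≠ a → c ≠ b → ‖c (u : K)‖ < 1 ∧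
        1 < ‖a (u : K)‖ * ‖c (u : K)‖ ∧ 1 < ‖b (u : K)‖ * ‖c (u : K)‖ := by
  classical
  obtain ⟨S, hS⟩ := exists_finset_infinitePlace_sum_mult_eq_two hK
  have hv : ∑ w : InfinitePlace K, (w.mult : ℝ) * (if w ∈ S then (3 : ℝ) else -2) = 0 := by
    have h1 : ∀ w : InfinitePlace K, (w.mult : ℝ) * (if w ∈ S then (3 : ℝ) else -2)
        = -2 * (w.mult : ℝ) + if w ∈ S then 5 * (w.mult : ℝ) else 0 := by
      intro w; split_ifs <;> ring
    have hsum : (∑ w : InfinitePlace K, (w.mult : ℝ)) = 5 := by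
      exact_mod_cast (sum_mult_eq (K := K)).trans hK
    have hS' : (∑ w ∈ S, (w.mult : ℝ)) = 2 := by exact_mod_cast hS
    simp only [h1, Finset.sum_add_distrib, ← Finset.mul_sum, Finset.sum_ite_mem,
      Finset.univ_inter, hsum, hS']
    norm_num
  -- The weights balance because `2 * 3 = 3 * 2`. With error `t / 4`, a large logarithm exceeds
  -- `5t/2` and a small one exceeds `-9t/4`, so their sum stays positive.
  obtain ⟨u, t, ht, hu⟩ := exists_unit_log_near _ hv (ε := 1 / 4) (by norm_num)
  have hcard : (Finset.univ.filter fun φ : K →+* ℂ => mk φ ∈ S).card = 2 := by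
    rw [← hS, Finset.card_eq_sum_card_fiberwise (f := mk) (t := S) (fun φ hφ => by simpa using hφ)]
    refine Finset.sum_congr rfl fun w hw => ?_
    rw [← card_filter_mk_eq, Finset.filter_filter]
    congr 1
    ext φ
    simp only [Finset.mem_filter, Finset.mem_univ, true_and, and_iff_right_iff_imp]
    rintro rfl
    exact hw
  obtain ⟨a, b, hab, hfil⟩ := Finset.card_eq_two.mp hcard
  have hmem : ∀ φ : K →+* ℂ, mk φ ∈ S ↔ φ = a ∨ φ = b := fun φ => by
    simpa using Finset.ext_iff.mp hfil φ
  have hpos : ∀ φ : K →+* ℂ, 0 < ‖φ (u : K)‖ := fun φ => by simp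
  have hsmall : ∀ φ : K →+* ℂ, mk φ ∉ S →
      -2 * t - t / 4 < Real.log ‖φ (u : K)‖ ∧ Real.log ‖φ (u : K)‖ < 0 := fun φ hφ => by
    have := hu (mk φ)
    rw [if_neg hφ, abs_lt, InfinitePlace.apply] at this
    constructor <;> linarith [this.1, this.2]
  have hbig : ∀ φ : K →+* ℂ, mk φ ∈ S → 5 / 2 * t < Real.log ‖φ (u : K)‖ := fun φ hφ => by
    have := hu (mk φ)
    rw [if_pos hφ, abs_lt, InfinitePlace.apply] at this
    linarith [this.1]
  have ha := (hmem a).2 (Or.inl rfl)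
  have hb := (hmem b).2 (Or.inr rfl)
  refine ⟨u, a, b, hab, ?_, ?_, fun c hca hcb => ?_⟩
  · exact (Real.log_pos_iff (hpos _).le).mp (by linarith [hbig a ha])
  · exact (Real.log_pos_iff (hpos _).le).mp (by linarith [hbig b hb])
  · have hc := hsmall c (by rw [hmem]; tauto)
    refine ⟨(Real.log_neg_iff (hpos _)).mp hc.2, ?_, ?_⟩
    · refine (Real.log_pos_iff (by positivity)).mp ?_
      rw [Real.log_mul (hpos _).ne' (hpos _).ne']
      linarith [hbig a ha]
    · refine (Real.log_pos_iff (by positivity)).mp ?_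
      rw [Real.log_mul (hpos _).ne' (hpos _).ne']
      linarith [hbig b hb]

end UnitApproximation

/-! ### Mahler measures of algebraic integers -/

theorem intMinpoly_associated_minpoly_int {α : ℂ} (hα : IsIntegral ℤ α) :
    Associated (intMinpoly α) (minpoly ℤ α) := by
  have h1 : (intMinpoly α).IsPrimitive := intMinpoly_isPrimitive α
  have h2 : (minpoly ℤ α).IsPrimitive := (minpoly.monic hα).isPrimitive
  have h := intMinpoly_associated (α := α) (hα.tower_top (A := ℚ)).isAlgebraic
  rw [minpoly.isIntegrallyClosed_eq_field_fractions' ℚ hα] at h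
  exact associated_of_dvd_dvd
    ((IsPrimitive.Int.dvd_iff_map_cast_dvd_map_cast _ _ h1).2 h.dvd)
    ((IsPrimitive.Int.dvd_iff_map_cast_dvd_map_cast _ _ h2).2 h.symm.dvd)

/-- The Mahler measure of an algebraic integer in terms of the complex roots of its minimal
polynomial. -/
theorem mahlerM_eq_prod_roots {α : ℂ} (hα : IsIntegral ℤ α) :
    mahlerM α = (((minpoly ℚ α).aroots ℂ).map fun z => max 1 ‖z‖).prod := by
  obtain ⟨v, hv⟩ := intMinpoly_associated_minpoly_int hα
  have hunit : ((v : ℤ[X]).map (Int.castRingHom ℂ)).mahlerMeasure = 1 := by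
    obtain ⟨r, hr, hrv⟩ := Polynomial.isUnit_iff.mp v.isUnit
    rw [← hrv, map_C, mahlerMeasure_const]
    rcases Int.isUnit_iff.mp hr with rfl | rfl <;> simp
  have hmap : (minpoly ℤ α).map (Int.castRingHom ℂ) = (minpoly ℚ α).map (algebraMap ℚ ℂ) := by
    rw [minpoly.isIntegrallyClosed_eq_field_fractions' ℚ hα, Polynomial.map_map]
    congr 1
  have hmeas : ((intMinpoly α).map (Int.castRingHom ℂ)).mahlerMeasure
      = ((minpoly ℚ α).map (algebraMap ℚ ℂ)).mahlerMeasure := by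
    rw [← hmap, ← hv, Polynomial.map_mul, mahlerMeasure_mul, hunit, mul_one]
  rw [mahlerM, hmeas, mahlerMeasure_eq_leadingCoeff_mul_prod_roots,
    ((minpoly.monic (hα.tower_top (A := ℚ))).map _).leadingCoeff]
  simp [aroots_def]

/-- The Mahler measure of an algebraic integer in terms of an enumeration of its Galois orbit. -/
theorem mahlerM_eq_prod_orbit {E : IntermediateField ℚ ℂ} [Normal ℚ E] {I : Type*} [Fintype I]
    {g : I → E} (hg : Function.Injective g) {i₀ : I} (hint : IsIntegral ℤ (g i₀ : ℂ))
    (h₁ : ∀ γ : E ≃ₐ[ℚ] E, ∃ i, γ (g i₀) = g i) (h₂ : ∀ i, ∃ γ : E ≃ₐ[ℚ] E, γ (g i₀) = g i) :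
    mahlerM (g i₀) = ((∏ i, max 1 ‖(g i : ℂ)‖ : ℝ) : ℂ) := by
  have hmin : minpoly ℚ (g i₀ : ℂ) = minpoly ℚ (g i₀) :=
    minpoly.algebraMap_eq (algebraMap E ℂ).injective (g i₀)
  have hintE : IsIntegral ℚ (g i₀) := Normal.isIntegral ‹_› _
  have hroots : (minpoly ℚ (g i₀ : ℂ)).aroots ℂ = Finset.univ.val.map fun i => (g i : ℂ) := by
    refine (Multiset.Nodup.ext ?_ ?_).2 fun z => ?_
    · exact nodup_aroots_iff_of_splits (minpoly.ne_zero (hint.tower_top (A := ℚ)))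
        (IsAlgClosed.splits _) |>.2 (minpoly.irreducible (hint.tower_top (A := ℚ))).separable
    · exact Finset.univ.nodup.map (Subtype.val_injective.comp hg)
    · simp only [Multiset.mem_map, Finset.mem_val, Finset.mem_univ, true_and]
      rw [hmin]
      constructor
      -- By normality the complex roots already lie in `E`, where conjugate elements are related by
      -- an automorphism.
      · intro hz
        rw [← Polynomial.aroots_map ℂ E, aroots_def, (Normal.splits ‹_› (g i₀)).roots_map] at hz
        obtain ⟨y, hy, rfl⟩ := Multiset.mem_map.mp hz
        have hy' : IsConjRoot ℚ (g i₀) y :=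
          (isConjRoot_iff_aeval_eq_zero hintE).2 (mem_aroots.mp hy).2
        obtain ⟨γ, hγ⟩ := isConjRoot_iff_exists_algEquiv.mp hy'.symm
        obtain ⟨i, hi⟩ := h₁ γ
        exact ⟨i, by rw [← hi, ← hγ]; rfl⟩
      · rintro ⟨i, rfl⟩
        obtain ⟨γ, hγ⟩ := h₂ i
        rw [mem_aroots, ← hγ]
        refine ⟨minpoly.ne_zero hintE, ?_⟩
        have h : aeval (γ (g i₀)) (minpoly ℚ (g i₀)) = 0 := by
          rw [aeval_algHom_apply, minpoly.aeval, map_zero]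
        have := congrArg (algebraMap E ℂ) h
        rwa [← aeval_algebraMap_apply, map_zero] at this
  rw [mahlerM_eq_prod_roots hint, hroots, Multiset.map_map]
  rfl

/-! ### The pentagon labelling -/

/-- A transitive group of permutations of five points contains a rotation of a pentagon in which
two given points are adjacent. -/
theorem exists_pentagon_labelling {Γ ι : Type*} [Group Γ] [MulAction Γ ι] [Fintype ι]
    [MulAction.IsPretransitive Γ ι] (hι : Fintype.card ι = 5) {a b : ι} (hab : a ≠ b) :
    ∃ (γ : Γ) (e : ZMod 5 ≃ ι), e 2 = a ∧ e 3 = b ∧ ∀ i, γ • e i = e (i + 1) := by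
  classical
  have : Fact (Nat.Prime 5) := ⟨by norm_num⟩
  -- `Γ` may be infinite; its image is finite, so orbit-stabilizer and Cauchy's theorem yield a
  -- 5-cycle there.
  let P := (MulAction.toPermHom Γ ι).range
  have htrans : MulAction.IsPretransitive P ι := ⟨fun x y => by
    obtain ⟨γ, hγ⟩ := MulAction.exists_smul_eq Γ x y
    exact ⟨⟨_, γ, rfl⟩, hγ⟩⟩
  have hdvd : 5 ∣ Nat.card P := by
    have h := MulAction.index_stabilizer_of_transitive P a
    rw [Nat.card_eq_fintype_card, hι] at h
    exact h ▸ Subgroup.index_dvd_card _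
  obtain ⟨⟨_, γ₀, rfl⟩, hx⟩ := exists_prime_orderOf_dvd_card' 5 hdvd
  set τ₀ := MulAction.toPermHom Γ ι γ₀
  have hτ₀ : orderOf τ₀ = 5 := by rwa [← Subgroup.orderOf_coe] at hx
  have hfive : ∀ σ : Equiv.Perm ι, orderOf σ = 5 → σ.IsCycle ∧ ∀ x, σ x ≠ x := by
    intro σ hσ
    have hcyc : σ.IsCycle := Equiv.Perm.isCycle_of_prime_order'' (by rw [hι]; norm_num)
      (by rw [hσ, hι])
    have hsupp : σ.support = Finset.univ := by
      rw [← Finset.card_eq_iff_eq_univ, ← hcyc.orderOf, hσ, hι]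
    exact ⟨hcyc, fun x => by rw [← Equiv.Perm.mem_support, hsupp]; exact Finset.mem_univ _⟩
  obtain ⟨hcyc, hne⟩ := hfive τ₀ hτ₀
  obtain ⟨k, hk⟩ := hcyc.exists_zpow_eq (hne a) (hne b)
  set τ := τ₀ ^ k
  have hτ5 : τ ^ 5 = 1 := by
    rw [← zpow_natCast, ← zpow_mul, mul_comm, zpow_mul, zpow_natCast, ← hτ₀, pow_orderOf_eq_one,
      one_zpow]
  have hτ : orderOf τ = 5 := orderOf_eq_prime hτ5 fun h => hab (by simpa [h] using hk)
  obtain ⟨hτcyc, hτne⟩ := hfive τ hτ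
  have hmod : ∀ n : ℕ, τ ^ n = τ ^ (n % 5) := fun n => by
    conv_lhs => rw [← Nat.mod_add_div n 5, pow_add, pow_mul, hτ5, one_pow, mul_one]
  -- The shift by 3 puts `a = τ ^ 5 a` at label 2 and `b = τ ^ 6 a` at label 3, the side opposite to
  -- 0.
  let f : ZMod 5 → ι := fun i => (τ ^ (i.val + 3)) a
  have hf : Function.Surjective f := fun x => by
    obtain ⟨n, hn⟩ := hτcyc.exists_pow_eq (hτne a) (hτne x)
    refine ⟨((n + 2 : ℕ) : ZMod 5), ?_⟩
    simp only [f, ZMod.val_natCast]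
    rw [hmod, show ((n + 2) % 5 + 3) % 5 = n % 5 by omega, ← hmod, hn]
  have hbij : Function.Bijective f :=
    (Fintype.bijective_iff_surjective_and_card f).2 ⟨hf, by rw [hι, ZMod.card]⟩
  refine ⟨γ₀ ^ k, Equiv.ofBijective f hbij, ?_, ?_, fun i => ?_⟩
  · change (τ ^ 5) a = a
    rw [hτ5]; rfl
  · change (τ ^ 6) a = b
    rw [pow_succ, hτ5, one_mul, hk]
  · have hact : ∀ x, (γ₀ ^ k) • x = τ x := fun x => by
      rw [← MulAction.toPerm_apply, ← MulAction.toPermHom_apply, map_zpow]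
    rw [hact]
    simp only [Equiv.ofBijective_apply, f]
    rw [← Equiv.Perm.mul_apply, ← pow_succ', hmod (i.val + 3 + 1), hmod ((i + 1).val + 3),
      ZMod.val_add]
    congr 2
    rw [show (1 : ZMod 5).val = 1 from rfl]
    omega

/-! ### Wandering criteria and elementary products -/

theorem isWandering_of_invariant {P : ℂ → Prop}
    (hP : ∀ x, P x → P (mahlerM x) ∧ ‖x‖ < ‖mahlerM x‖) {x : ℂ} (hx : P x) : IsWandering x := by
  have hiter : ∀ n, P (mahlerM^[n] x) := fun n => by
    induction n with
    | zero => exact hx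
    | succ n ih => rw [Function.iterate_succ_apply']; exact (hP _ ih).1
  have hmono : StrictMono fun n => ‖mahlerM^[n] x‖ := strictMono_nat_of_lt_succ fun n => by
    rw [Function.iterate_succ_apply']; exact (hP _ (hiter n)).2
  exact Set.infinite_range_of_injective fun m n h => hmono.injective (congrArg norm h)

theorem IsWandering.of_mahlerM {x : ℂ} (h : IsWandering (mahlerM x)) : IsWandering x := by
  refine h.mono ?_
  rintro _ ⟨n, rfl⟩
  exact ⟨n + 1, Function.iterate_succ_apply _ _ _⟩

/-- One of `k`, `l` differs from `i`, and its factor makes the inequality strict. -/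
theorem lt_prod_max_one {I : Type*} [Fintype I] [DecidableEq I] {a : I → ℝ} {k l : I} (hkl : k ≠ l)
    (hk : 1 < a k) (hl : 1 < a l) (i : I) : a i < ∏ m, max 1 (a m) := by
  obtain ⟨m, hmi, hm⟩ : ∃ m, m ≠ i ∧ 1 < a m := by
    by_cases h : k = i
    · exact ⟨l, fun h' => hkl (h.trans h'.symm), hl⟩
    · exact ⟨k, h, hk⟩
  have hone : ∀ m, 1 ≤ max 1 (a m) := fun m => le_max_left _ _
  have h1 : max 1 (a m) ≤ ∏ j ∈ Finset.univ.erase i, max 1 (a j) := by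
    rw [← Finset.mul_prod_erase _ _ (Finset.mem_erase.2 ⟨hmi, Finset.mem_univ m⟩)]
    refine le_mul_of_one_le_right (zero_le_one.trans (hone m)) ?_
    exact Finset.one_le_prod fun j _ => hone j
  rw [← Finset.mul_prod_erase _ _ (Finset.mem_univ i)]
  calc a i ≤ max 1 (a i) := le_max_right _ _
    _ < max 1 (a i) * max 1 (a m) :=
        lt_mul_of_one_lt_right (zero_lt_one.trans_le (hone i)) (hm.trans_le (le_max_right _ _))
    _ ≤ _ := mul_le_mul_of_nonneg_left h1 (zero_le_one.trans (hone i))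

/-- Multiply by `∏ a i = 1` and use `a * max 1 a⁻¹ = max a 1` in each factor. This is why a unit and
its inverse have the same Mahler measure. -/
theorem prod_max_one_inv {I : Type*} [Fintype I] {a : I → ℝ} (ha : ∀ i, 0 ≤ a i)
    (h : ∏ i, a i = 1) : ∏ i, max 1 (a i)⁻¹ = ∏ i, max 1 (a i) := by
  rw [← one_mul (∏ i, max 1 (a i)⁻¹)]
  nth_rw 1 [← h]
  rw [← Finset.prod_mul_distrib]
  refine Finset.prod_congr rfl fun i _ => ?_
  have h0 : a i ≠ 0 := fun h0 => by
    rw [Finset.prod_eq_zero (Finset.mem_univ i) h0] at h; exact zero_ne_one h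
  rw [mul_max_of_nonneg _ _ (ha i), mul_one, mul_inv_cancel₀ h0, max_comm]

theorem prod_zmod_five {M : Type*} [CommMonoid M] (a : ZMod 5 → M) (j : ZMod 5) :
    ∏ i, a i = a j * (a (j + 1) * a (j - 1)) * (a (j + 2) * a (j - 2)) := by
  rw [← Equiv.prod_comp (Equiv.addLeft j) a]
  have h := Fin.prod_univ_five fun i : Fin 5 => a ((Equiv.addLeft j) i)
  refine h.trans ?_
  have e0 : (Equiv.addLeft j) (0 : ZMod 5) = j := add_zero j
  have e3 : (Equiv.addLeft j) (3 : ZMod 5) = j - 2 := by clear h; revert j; decide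
  have e4 : (Equiv.addLeft j) (4 : ZMod 5) = j - 1 := by clear h e0 e3; revert j; decide
  change a ((Equiv.addLeft j) (0 : ZMod 5)) * a ((Equiv.addLeft j) (1 : ZMod 5)) *
    a ((Equiv.addLeft j) (2 : ZMod 5)) * a ((Equiv.addLeft j) (3 : ZMod 5)) *
    a ((Equiv.addLeft j) (4 : ZMod 5)) = _
  rw [e0, e3, e4]
  simp only [Equiv.coe_addLeft]
  ac_rfl

theorem ofReal_norm_eq_or_eq_neg {x : ℂ} (hx : (starRingEnd ℂ) x = x) :
    ((‖x‖ : ℝ) : ℂ) = x ∨ ((‖x‖ : ℝ) : ℂ) = -x := by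
  obtain ⟨r, rfl⟩ := Complex.conj_eq_iff_real.mp hx
  rw [Complex.norm_real, Real.norm_eq_abs]
  rcases abs_choice r with h | h <;> simp [h]

theorem exists_algEquiv_conj (E : IntermediateField ℚ ℂ) [Normal ℚ E] :
    ∃ γ : E ≃ₐ[ℚ] E, ∀ x : E, (γ x : ℂ) = (starRingEnd ℂ) x :=
  ⟨(Complex.conjAe.restrictScalars ℚ).restrictNormal E, fun x =>
    AlgEquiv.restrictNormal_commutes (Complex.conjAe.restrictScalars ℚ) E x⟩

/-! ### Conjugate families of units -/

/-- A family of five units which is permuted by the Galois group through `π`. -/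
structure IsConjFamily {E : IntermediateField ℚ ℂ} (π : (E ≃ₐ[ℚ] E) →* Equiv.Perm (ZMod 5))
    (f : ZMod 5 → E) : Prop where
  map_apply : ∀ γ i, γ (f i) = f (π γ i)
  isIntegral : ∀ i, IsIntegral ℤ (f i : ℂ)
  isIntegral_inv : ∀ i, IsIntegral ℤ (f i : ℂ)⁻¹
  norm_prod : ∏ i, ‖(f i : ℂ)‖ = 1

namespace IsConjFamily

variable {E : IntermediateField ℚ ℂ} {π : (E ≃ₐ[ℚ] E) →* Equiv.Perm (ZMod 5)} {f : ZMod 5 → E}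

theorem neg (hf : IsConjFamily π f) : IsConjFamily π (-f) where
  map_apply γ i := by simp [hf.map_apply]
  isIntegral i := by simpa using (hf.isIntegral i).neg
  isIntegral_inv i := by simpa using (hf.isIntegral_inv i).neg
  norm_prod := by simpa using hf.norm_prod

theorem inv (hf : IsConjFamily π f) : IsConjFamily π f⁻¹ where
  map_apply γ i := by simp [hf.map_apply]
  isIntegral i := by simpa using hf.isIntegral_inv i
  isIntegral_inv i := by simpa using hf.isIntegral i
  norm_prod := by simpa using hf.norm_prod

theorem norm_pos (hf : IsConjFamily π f) (i : ZMod 5) : 0 < ‖(f i : ℂ)‖ := by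
  refine (norm_nonneg _).lt_of_ne' fun h => ?_
  have := hf.norm_prod
  rw [Finset.prod_eq_zero (Finset.mem_univ i) h] at this
  exact zero_ne_one this

/-- Complex conjugation permutes the labels and preserves absolute values. -/
theorem exists_conj [Normal ℚ E] (hf : IsConjFamily π f) :
    ∃ γ : E ≃ₐ[ℚ] E, (∀ x : E, (γ x : ℂ) = (starRingEnd ℂ) x) ∧
      ∀ i, ‖(f (π γ i) : ℂ)‖ = ‖(f i : ℂ)‖ := by
  obtain ⟨γ, hγ⟩ := exists_algEquiv_conj E
  exact ⟨γ, hγ, fun i => by rw [← hf.map_apply, hγ, RCLike.norm_conj]⟩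

theorem exists_rotation {ρ : E ≃ₐ[ℚ] E} (hρ : ∀ i, π ρ i = i + 1) (k : ZMod 5) :
    ∃ γ, ∀ i, π γ i = i + k := by
  have h : ∀ n : ℕ, ∀ i, π (ρ ^ n) i = i + n := fun n => by
    induction n with
    | zero => simp
    | succ n ih => intro i; rw [pow_succ, map_mul, Equiv.Perm.mul_apply, hρ, ih]; push_cast; ring
  exact ⟨ρ ^ k.val, fun i => by rw [h, ZMod.natCast_zmod_val]⟩

/-- A coincidence `f m = f n` would make `f` invariant under translation by `n - m`, which generates
`ZMod 5`, so `f` would be constant. Two different absolute values exclude this, and the family is a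
full Galois orbit without repetition. -/
theorem mahlerM_apply [Normal ℚ E] (hf : IsConjFamily π f) {ρ : E ≃ₐ[ℚ] E}
    (hρ : ∀ i, π ρ i = i + 1) {k l : ZMod 5} (hkl : ‖(f k : ℂ)‖ ≠ ‖(f l : ℂ)‖) (i : ZMod 5) :
    mahlerM (f i) = ((∏ m, max 1 ‖(f m : ℂ)‖ : ℝ) : ℂ) := by
  refine mahlerM_eq_prod_orbit ?_ (hf.isIntegral i) (fun γ => ⟨_, hf.map_apply γ i⟩) fun j => ?_
  · intro m n hmn
    by_contra hne
    have hstep : ∀ x, f (x + (n - m)) = f x := fun x => by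
      obtain ⟨γ, hγ⟩ := exists_rotation hρ (x - m)
      have h := congrArg γ hmn
      rw [hf.map_apply, hf.map_apply, hγ, hγ] at h
      rw [show x + (n - m) = n + (x - m) by ring, ← h]
      congr 1; ring
    have hmul : ∀ (t : ℕ) x, f (x + t * (n - m)) = f x := fun t => by
      induction t with
      | zero => simp
      | succ t ih => intro x; rw [← ih x, ← hstep (x + t * (n - m))]; congr 1; push_cast; ring
    have : Fact (Nat.Prime 5) := ⟨by norm_num⟩
    have h := hmul ((l - k) / (n - m)).val k
    rw [ZMod.natCast_zmod_val, div_mul_cancel₀ _ (sub_ne_zero.2 (Ne.symm hne)),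
      add_sub_cancel] at h
    exact hkl (by rw [h])
  · obtain ⟨γ, hγ⟩ := exists_rotation hρ (j - i)
    exact ⟨γ, by rw [hf.map_apply, hγ, add_sub_cancel]⟩

end IsConjFamily

/-! ### Sign patterns on the pentagon -/

/-- The sign pattern of a function on a pentagon which exceeds `1` exactly on the side opposite
to `j`. -/
structure IsLargeOppositeTo (a : ZMod 5 → ℝ) (j : ZMod 5) : Prop where
  right : 1 < a (j + 2)
  left : 1 < a (j - 2)
  centre : a j < 1
  right_le : a (j + 1) ≤ 1
  left_le : a (j - 1) ≤ 1
  mul_lt : a (j + 1) * a (j - 1) < 1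

namespace IsLargeOppositeTo

variable {a : ZMod 5 → ℝ} {j : ZMod 5}

theorem prod_max_one (h : IsLargeOppositeTo a j) :
    ∏ i, max 1 (a i) = a (j + 2) * a (j - 2) := by
  rw [prod_zmod_five _ j, max_eq_left h.centre.le, max_eq_left h.right_le, max_eq_left h.left_le,
    max_eq_right h.right.le, max_eq_right h.left.le, mul_one, mul_one, one_mul]

theorem one_lt_iff (h : IsLargeOppositeTo a j) (i : ZMod 5) :
    1 < a i ↔ i = j + 2 ∨ i = j - 2 := by
  have hi : i = j ∨ i = j + 1 ∨ i = j - 1 ∨ i = j + 2 ∨ i = j - 2 := by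
    clear h; revert i j; decide
  constructor
  · intro h1
    rcases hi with rfl | rfl | rfl | hi | hi
    · exact absurd h1 h.centre.le.not_gt
    · exact absurd h1 h.right_le.not_gt
    · exact absurd h1 h.left_le.not_gt
    · exact Or.inl hi
    · exact Or.inr hi
  · rintro (rfl | rfl)
    exacts [h.right, h.left]

/-- The sign pattern is inherited, up to inversion, by the products over opposite sides. -/
theorem exists_opposite (h : IsLargeOppositeTo a j) (hpos : ∀ i, 0 < a i) (hprod : ∏ i, a i = 1) :
    ∃ k, IsLargeOppositeTo (fun i => a (i + 2) * a (i - 2)) k ∨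
      IsLargeOppositeTo (fun i => (a (i + 2) * a (i - 2))⁻¹) k := by
  set b : ZMod 5 → ℝ := fun i => a (i + 2) * a (i - 2) with hb
  have e1 : j + 1 + 2 = j - 2 := by clear h; revert j; decide
  have e2 : j + 1 - 2 = j - 1 := by ring
  have e3 : j - 1 + 2 = j + 1 := by ring
  have e4 : j - 1 - 2 = j + 2 := by clear h; revert j; decide
  have e5 : j + 2 + 2 = j - 1 := by clear h; revert j; decide
  have e6 : j + 2 - 2 = j := by ring
  have e7 : j - 2 + 2 = j := by ring
  have e8 : j - 2 - 2 = j + 1 := by clear h; revert j; decide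
  have b0 : 1 < b j := one_lt_mul_of_lt_of_le h.right h.left.le
  have b2 : b (j + 2) < 1 := by
    simp only [hb, e5, e6]
    exact mul_lt_one_of_nonneg_of_lt_one_right h.left_le (hpos _).le h.centre
  have b3 : b (j - 2) < 1 := by
    simp only [hb, e7, e8]
    exact mul_lt_one_of_nonneg_of_lt_one_left (hpos _).le h.centre h.right_le
  have bpos : ∀ i, 0 < b i := fun i => mul_pos (hpos _) (hpos _)
  -- This product is `(a j)⁻¹`, since it omits only the vertex `j`.
  have b14 : 1 < b (j + 1) * b (j - 1) := by
    simp only [hb, e1, e2, e3, e4]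
    rw [prod_zmod_five a j] at hprod
    have : a (j - 2) * a (j - 1) * (a (j + 1) * a (j + 2)) * a j = 1 := by rw [← hprod]; ring
    by_contra hle
    rw [not_lt] at hle
    have := mul_lt_one_of_nonneg_of_lt_one_right hle (hpos j).le h.centre
    linarith
  -- By `b14`, at least one neighbour of `j` exceeds 1. If exactly one does, it forms the large side
  -- with `j`; if both do, only `b (j + 2)` and `b (j - 2)` lie below 1 and inversion restores the
  -- pattern. The other neighbour may equal 1, hence the weak inequalities in the pattern.
  by_cases h1 : b (j + 1) ≤ 1
  · have h4 : 1 < b (j - 1) := by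
      by_contra hle
      rw [not_lt] at hle
      exact absurd b14 (mul_le_one₀ h1 (bpos _).le hle).not_gt
    refine ⟨j + 2, Or.inl ?_⟩
    constructor
    · rwa [e5]
    · rwa [e6]
    · exact b2
    · rw [show j + 2 + 1 = j - 2 by clear * -; revert j; decide]; exact b3.le
    · rwa [show j + 2 - 1 = j + 1 by ring]
    · rw [show j + 2 + 1 = j - 2 by clear * -; revert j; decide, show j + 2 - 1 = j + 1 by ring]
      exact mul_lt_one_of_nonneg_of_lt_one_left (bpos _).le b3 h1
  · rw [not_le] at h1
    by_cases h4 : b (j - 1) ≤ 1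
    · refine ⟨j - 2, Or.inl ?_⟩
      constructor
      · rwa [e7]
      · rwa [e8]
      · exact b3
      · rwa [show j - 2 + 1 = j - 1 by ring]
      · rw [show j - 2 - 1 = j + 2 by clear * -; revert j; decide]; exact b2.le
      · rw [show j - 2 - 1 = j + 2 by clear * -; revert j; decide, show j - 2 + 1 = j - 1 by ring]
        exact mul_lt_one_of_nonneg_of_lt_one_right h4 (bpos _).le b2
    · rw [not_le] at h4
      refine ⟨j, Or.inr ⟨?_, ?_, ?_, ?_, ?_, ?_⟩⟩
      · exact (one_lt_inv₀ (bpos _)).2 b2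
      · exact (one_lt_inv₀ (bpos _)).2 b3
      · exact inv_lt_one_of_one_lt₀ b0
      · exact inv_le_one_of_one_le₀ h1.le
      · exact inv_le_one_of_one_le₀ h4.le
      · exact mul_lt_one_of_nonneg_of_lt_one_left (inv_pos.2 (bpos _)).le
          (inv_lt_one_of_one_lt₀ h1) (inv_le_one_of_one_le₀ h4.le)

end IsLargeOppositeTo

/-! ### Galois image preserving the pentagon -/

section Pentagon

variable {E : IntermediateField ℚ ℂ} {π : (E ≃ₐ[ℚ] E) →* Equiv.Perm (ZMod 5)}
  {f : ZMod 5 → E}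

/-- The family of products over the sides of the pentagon, each labelled by the opposite vertex. -/
noncomputable def oppositeSide (f : ZMod 5 → E) : ZMod 5 → E := fun i => f (i + 2) * f (i - 2)

/-- The permutation preserves the side opposite to each vertex. -/
def PreservesOpposite (σ : Equiv.Perm (ZMod 5)) : Prop :=
  ∀ i, (σ (i + 2) = σ i + 2 ∧ σ (i - 2) = σ i - 2) ∨ (σ (i + 2) = σ i - 2 ∧ σ (i - 2) = σ i + 2)

theorem preservesOpposite_of_adjacent {σ : Equiv.Perm (ZMod 5)}
    (h : ∀ i, σ (i + 1) = σ i + 1 ∨ σ (i + 1) = σ i - 1) : PreservesOpposite σ := by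
  intro i
  have h0 := h i
  have h1 := h (i + 1)
  have h2 := h (i + 2)
  rw [show i + 1 + 1 = i + 2 by ring] at h1
  rw [show i + 2 + 1 = i - 2 by clear * -; revert i; decide] at h2
  -- Injectivity keeps the image path from folding back, so it runs round the pentagon in one
  -- direction.
  have n1 : σ (i + 2) ≠ σ i := fun e => by
    have := σ.injective e; clear * - this; revert i; decide
  have n2 : σ (i - 2) ≠ σ (i + 1) := fun e => by
    have := σ.injective e; clear * - this; revert i; decide
  generalize σ i = x at *
  generalize σ (i + 1) = y at *
  generalize σ (i + 2) = z at *
  generalize σ (i - 2) = w at *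
  clear h
  revert x y z w
  decide

theorem IsConjFamily.oppositeSide (hπ : ∀ γ, PreservesOpposite (π γ)) (hf : IsConjFamily π f) :
    IsConjFamily π (oppositeSide f) where
  map_apply γ i := by
    simp only [_root_.oppositeSide, map_mul, hf.map_apply]
    rcases hπ γ i with ⟨h1, h2⟩ | ⟨h1, h2⟩ <;> rw [h1, h2]
    rw [mul_comm]
  isIntegral i := by
    simpa [_root_.oppositeSide] using (hf.isIntegral _).mul (hf.isIntegral _)
  isIntegral_inv i := by
    simpa [_root_.oppositeSide, mul_comm] using (hf.isIntegral_inv _).mul (hf.isIntegral_inv _)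
  norm_prod := by
    simp only [_root_.oppositeSide, MulMemClass.coe_mul, norm_mul, Finset.prod_mul_distrib]
    have h1 := Equiv.prod_comp (Equiv.addRight (2 : ZMod 5)) fun i => ‖(f i : ℂ)‖
    have h2 := Equiv.prod_comp (Equiv.subRight (2 : ZMod 5)) fun i => ‖(f i : ℂ)‖
    rw [hf.norm_prod] at h1 h2
    exact (congrArg₂ (· * ·) h1 h2).trans (mul_one 1)

variable (π) in
/-- `x` belongs to a conjugate family whose absolute values, or their inverses, exceed `1` exactly
on one side of the pentagon. -/
def IsPentagonal (x : ℂ) : Prop :=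
  ∃ f : ZMod 5 → E, IsConjFamily π f ∧ (∃ i, x = f i) ∧
    ∃ j, IsLargeOppositeTo (fun i => ‖(f i : ℂ)‖) j ∨ IsLargeOppositeTo (fun i => ‖(f i : ℂ)‖⁻¹) j

/-- The Mahler measure is the absolute value of the product over the large side. Complex conjugation
preserves that side and so fixes the opposite vertex `j`; the product is therefore real, and up to
sign the measure belongs to the family of side products. -/
theorem isPentagonal_mahlerM [Normal ℚ E] {ρ : E ≃ₐ[ℚ] E} (hρ : ∀ i, π ρ i = i + 1)
    (hπ : ∀ γ, PreservesOpposite (π γ)) (hf : IsConjFamily π f) {j : ZMod 5}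
    (hj : IsLargeOppositeTo (fun i => ‖(f i : ℂ)‖) j) (i : ZMod 5) :
    IsPentagonal π (mahlerM (f i)) := by
  have hne : ‖(f (j + 2) : ℂ)‖ ≠ ‖(f j : ℂ)‖ := (hj.centre.trans hj.right).ne'
  obtain ⟨γ, hγ, hγnorm⟩ := hf.exists_conj
  have hfix : π γ j = j := by
    have h1 : π γ (j + 2) = j + 2 ∨ π γ (j + 2) = j - 2 :=
      (hj.one_lt_iff _).1 (by rw [hγnorm]; exact hj.right)
    have h2 : π γ (j - 2) = j + 2 ∨ π γ (j - 2) = j - 2 :=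
      (hj.one_lt_iff _).1 (by rw [hγnorm]; exact hj.left)
    have h := hπ γ j
    generalize π γ j = x at *
    generalize π γ (j + 2) = y at *
    generalize π γ (j - 2) = z at *
    clear * - h h1 h2
    revert j x y z
    decide
  have hg := hf.oppositeSide hπ
  have hreal : (starRingEnd ℂ) (oppositeSide f j : ℂ) = oppositeSide f j := by
    rw [← hγ, hg.map_apply, hfix]
  have hM : mahlerM (f i) = ((‖(oppositeSide f j : ℂ)‖ : ℝ) : ℂ) := by
    rw [hf.mahlerM_apply hρ hne, hj.prod_max_one]
    simp [oppositeSide]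
  have hlarge := hj.exists_opposite hf.norm_pos hf.norm_prod
  rw [hM]
  rcases ofReal_norm_eq_or_eq_neg hreal with h | h
  · exact ⟨_, hg, ⟨j, h⟩, by simpa [oppositeSide] using hlarge⟩
  · exact ⟨_, hg.neg, ⟨j, by simpa using h⟩, by simpa [oppositeSide] using hlarge⟩

theorem IsPentagonal.mahlerM_and_norm_lt [Normal ℚ E] {ρ : E ≃ₐ[ℚ] E} (hρ : ∀ i, π ρ i = i + 1)
    (hπ : ∀ γ, PreservesOpposite (π γ)) {x : ℂ} (hx : IsPentagonal π x) :
    IsPentagonal π (mahlerM x) ∧ ‖x‖ < ‖mahlerM x‖ := by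
  obtain ⟨f, hf, ⟨i, rfl⟩, j, hj⟩ := hx
  have hpos : 0 ≤ ∏ m, max 1 ‖(f m : ℂ)‖ :=
    Finset.prod_nonneg fun m _ => zero_le_one.trans (le_max_left _ _)
  rcases hj with hj | hj
  · have hne : ‖(f (j + 2) : ℂ)‖ ≠ ‖(f j : ℂ)‖ := (hj.centre.trans hj.right).ne'
    refine ⟨isPentagonal_mahlerM hρ hπ hf hj i, ?_⟩
    rw [hf.mahlerM_apply hρ hne, Complex.norm_real, Real.norm_of_nonneg hpos]
    exact lt_prod_max_one (a := fun i => ‖(f i : ℂ)‖)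
      (by clear * -; revert j; decide : j + 2 ≠ j - 2) hj.right hj.left i
  · have hinv : IsLargeOppositeTo (fun i => ‖(f⁻¹ i : E)‖) j := by simpa using hj
    have hne : ‖(f (j + 2) : ℂ)‖ ≠ ‖(f j : ℂ)‖ := fun h =>
      (hj.centre.trans hj.right).ne (by simp only [h])
    have hne' : ‖(f⁻¹ (j + 2) : E)‖ ≠ ‖(f⁻¹ j : E)‖ := (hinv.centre.trans hinv.right).ne'
    have hM : mahlerM (f i) = mahlerM (f⁻¹ i : E) := by
      rw [hf.mahlerM_apply hρ hne, hf.inv.mahlerM_apply hρ hne',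
        ← prod_max_one_inv (fun i => norm_nonneg (f i : ℂ)) hf.norm_prod]
      simp
    refine ⟨hM ▸ isPentagonal_mahlerM hρ hπ hf.inv hinv i, ?_⟩
    rw [hf.mahlerM_apply hρ hne, Complex.norm_real, Real.norm_of_nonneg hpos]
    -- Growth needs two values above 1: one is at `j`, the other at a neighbour of `j`, because
    -- `mul_lt` forbids both neighbours from being at most 1.
    have h0 : 1 < ‖(f j : ℂ)‖ := by
      simpa using (one_lt_inv₀ (inv_pos.2 (hf.norm_pos j))).2 hj.centre
    rcases lt_or_ge 1 ‖(f (j + 1) : ℂ)‖ with h1 | h1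
    · exact lt_prod_max_one (a := fun i => ‖(f i : ℂ)‖)
        (by clear * -; revert j; decide : j ≠ j + 1) h0 h1 i
    · refine lt_prod_max_one (a := fun i => ‖(f i : ℂ)‖)
        (by clear * -; revert j; decide : j ≠ j - 1) h0 ?_ i
      by_contra h4
      rw [not_lt] at h4
      refine absurd hj.mul_lt (not_lt.2 ?_)
      exact one_le_mul_of_one_le_of_one_le ((one_le_inv₀ (hf.norm_pos _)).2 h1)
        ((one_le_inv₀ (hf.norm_pos _)).2 h4)

end Pentagon

/-! ### Galois image transitive on pairs -/

section Pairs

/-- A function on five points with two large values dominating the inverses of the other three. -/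
structure HasTwoDominant (a : ZMod 5 → ℝ) : Prop where
  pos : ∀ i, 0 < a i
  prod_eq : ∏ i, a i = 1
  one_lt_two : 1 < a 2
  one_lt_three : 1 < a 3
  lt_one : ∀ i, i ≠ 2 → i ≠ 3 → a i < 1
  one_lt_two_mul : ∀ i, i ≠ 2 → i ≠ 3 → 1 < a 2 * a i
  one_lt_three_mul : ∀ i, i ≠ 2 → i ≠ 3 → 1 < a 3 * a i

namespace HasTwoDominant

variable {a : ZMod 5 → ℝ}

theorem isLargeOppositeTo (h : HasTwoDominant a) : IsLargeOppositeTo a 0 where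
  right := h.one_lt_two
  left := h.one_lt_three
  centre := h.lt_one 0 (by decide) (by decide)
  right_le := (h.lt_one 1 (by decide) (by decide)).le
  left_le := (h.lt_one 4 (by decide) (by decide)).le
  mul_lt := mul_lt_one_of_nonneg_of_lt_one_left (h.pos 1).le (h.lt_one 1 (by decide) (by decide))
    (h.lt_one 4 (by decide) (by decide)).le

theorem prod_pair_lt (h : HasTwoDominant a) {s : Finset (ZMod 5)} (hs : s.card = 2)
    (hne : s ≠ {2, 3}) : ∏ i ∈ s, a i < a 2 * a 3 := by
  have hlt : ∀ i, a i < a 2 * a 3 := fun i => by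
    by_cases h2 : i = 2
    · rw [h2]; exact lt_mul_of_one_lt_right (h.pos 2) h.one_lt_three
    by_cases h3 : i = 3
    · rw [h3]; exact lt_mul_of_one_lt_left (h.pos 3) h.one_lt_two
    exact (h.lt_one i h2 h3).trans (one_lt_mul_of_lt_of_le h.one_lt_two h.one_lt_three.le)
  have key : ∀ i j, i ≠ 2 → i ≠ 3 → a i * a j < a 2 * a 3 := fun i j h2 h3 =>
    (mul_le_of_le_one_left (h.pos j).le (h.lt_one i h2 h3).le).trans_lt (hlt j)
  obtain ⟨i, j, hij, rfl⟩ := Finset.card_eq_two.mp hs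
  rw [Finset.prod_pair hij]
  by_cases hi : i ≠ 2 ∧ i ≠ 3
  · exact key i j hi.1 hi.2
  by_cases hj : j ≠ 2 ∧ j ≠ 3
  · rw [mul_comm]; exact key j i hj.1 hj.2
  refine absurd ?_ hne
  clear * - hij hi hj
  revert i j
  decide

/-- Exactly the seven pairs meeting `{2, 3}` contribute. Labels 2 and 3 occur four times each and 0,
1, 4 twice each, so the product is `(a 2 * a 3) ^ 4 * (a 0 * a 1 * a 4) ^ 2`, and the total product
is 1. -/
theorem prod_pairs_max_one (h : HasTwoDominant a) :
    ∏ s : {s : Finset (ZMod 5) // s.card = 2}, max 1 (∏ i ∈ s.1, a i) = (a 2 * a 3) ^ 2 := by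
  have h0 := h.lt_one 0 (by decide) (by decide)
  have h1 := h.lt_one 1 (by decide) (by decide)
  have h4 := h.lt_one 4 (by decide) (by decide)
  have hsub : ∏ s : {s : Finset (ZMod 5) // s.card = 2}, max 1 (∏ i ∈ s.1, a i)
      = ∏ s ∈ ({{0, 1}, {0, 2}, {0, 3}, {0, 4}, {1, 2}, {1, 3}, {1, 4}, {2, 3}, {2, 4}, {3, 4}} :
        Finset (Finset (ZMod 5))), max 1 (∏ i ∈ s, a i) :=
    (Finset.prod_subtype _ (by decide) fun s => max 1 (∏ i ∈ s, a i)).symm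
  have hp := h.prod_eq
  rw [prod_zmod_five a 0] at hp
  change a 0 * (a 1 * a 4) * (a 2 * a 3) = 1 at hp
  rw [hsub]
  iterate 9 rw [Finset.prod_insert (f := fun s => max 1 (∏ i ∈ s, a i)) (by decide)]
  rw [Finset.prod_singleton]
  repeat rw [Finset.prod_pair (by decide)]
  have lt : ∀ i j, a i < 1 → a j < 1 → max 1 (a i * a j) = 1 := fun i j hi hj =>
    max_eq_left (mul_lt_one_of_nonneg_of_lt_one_left (h.pos i).le hi hj.le).le
  rw [lt 0 1 h0 h1, lt 0 4 h0 h4, lt 1 4 h1 h4,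
    max_eq_right (mul_comm (a 2) (a 0) ▸ h.one_lt_two_mul 0 (by decide) (by decide)).le,
    max_eq_right (mul_comm (a 3) (a 0) ▸ h.one_lt_three_mul 0 (by decide) (by decide)).le,
    max_eq_right (mul_comm (a 2) (a 1) ▸ h.one_lt_two_mul 1 (by decide) (by decide)).le,
    max_eq_right (mul_comm (a 3) (a 1) ▸ h.one_lt_three_mul 1 (by decide) (by decide)).le,
    max_eq_right (one_lt_mul_of_lt_of_le h.one_lt_two h.one_lt_three.le).le,
    max_eq_right (h.one_lt_two_mul 4 (by decide) (by decide)).le,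
    max_eq_right (h.one_lt_three_mul 4 (by decide) (by decide)).le]
  calc _ = (a 0 * (a 1 * a 4) * (a 2 * a 3)) ^ 2 * (a 2 * a 3) ^ 2 := by ring
    _ = _ := by rw [hp, one_pow, one_mul]

end HasTwoDominant

theorem max_one_pow {x : ℝ} (hx : 0 ≤ x) (n : ℕ) : max 1 (x ^ n) = max 1 x ^ n := by
  rcases le_total 1 x with h | h
  · rw [max_eq_right h, max_eq_right (one_le_pow₀ h)]
  · rw [max_eq_left h, max_eq_left (pow_le_one₀ hx h), one_pow]

variable {E : IntermediateField ℚ ℂ} {π : (E ≃ₐ[ℚ] E) →* Equiv.Perm (ZMod 5)}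
  {f : ZMod 5 → E}

/-- If the Galois group is transitive on pairs, the Mahler measure squares the powers of the
dominant product. -/
theorem IsConjFamily.mahlerM_pair_pow [Normal ℚ E] (hf : IsConjFamily π f)
    (htrans : ∀ s : Finset (ZMod 5), s.card = 2 → ∃ γ, s.map (π γ).toEmbedding = {2, 3})
    (ha : HasTwoDominant fun i => ‖(f i : ℂ)‖) {c : E} (hc : c = 1 ∨ c = -1) {N : ℕ} (hN : N ≠ 0) :
    mahlerM (c * (f 2 * f 3) ^ N : E) = ((‖((f 2 * f 3 : E) : ℂ)‖ ^ (2 * N) : ℝ) : ℂ) := by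
  let g : {s : Finset (ZMod 5) // s.card = 2} → E := fun s => c * (∏ i ∈ s.1, f i) ^ N
  let act : (E ≃ₐ[ℚ] E) → {s : Finset (ZMod 5) // s.card = 2} →
      {s : Finset (ZMod 5) // s.card = 2} :=
    fun γ s => ⟨s.1.map (π γ).toEmbedding, by rw [Finset.card_map, s.2]⟩
  let s₀ : {s : Finset (ZMod 5) // s.card = 2} := ⟨{2, 3}, rfl⟩
  have hcnorm : ‖(c : ℂ)‖ = 1 := by rcases hc with rfl | rfl <;> simp
  have hcint : IsIntegral ℤ (c : ℂ) := by
    rcases hc with rfl | rfl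
    · simpa using isIntegral_one
    · simpa using (isIntegral_one (R := ℤ) (B := ℂ)).neg
  have hg : ∀ γ s, γ (g s) = g (act γ s) := fun γ s => by
    have hγc : γ c = c := by rcases hc with rfl | rfl <;> simp
    simp only [g, act, map_mul, map_pow, map_prod, hγc, Finset.prod_map, hf.map_apply,
      Equiv.coe_toEmbedding]
  have hnorm : ∀ s, ‖(g s : ℂ)‖ = (∏ i ∈ s.1, ‖(f i : ℂ)‖) ^ N := fun s => by
    simp [g, hcnorm]
  have hg₀ : g s₀ = c * (f 2 * f 3) ^ N := by
    simp only [g, s₀]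
    rw [Finset.prod_pair (by decide)]
  have huniq : ∀ s, g s = g s₀ → s = s₀ := fun s hs => by
    by_contra hne
    have h := congrArg (fun x : E => ‖(x : ℂ)‖) hs
    simp only [hnorm] at h
    have hlt := ha.prod_pair_lt s.2 fun h' => hne (Subtype.ext h')
    rw [← Finset.prod_pair (f := fun i => ‖(f i : ℂ)‖) (by decide : (2 : ZMod 5) ≠ 3)] at hlt
    exact (pow_lt_pow_left₀ hlt (Finset.prod_nonneg fun i _ => norm_nonneg _) hN).ne h
  have hact : ∀ s, ∃ γ, act γ s = s₀ := fun s => by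
    obtain ⟨γ, hγ⟩ := htrans s.1 s.2
    exact ⟨γ, Subtype.ext hγ⟩
  -- Transitivity moves any coincidence to `s₀`, where strict maximality of the absolute value
  -- excludes it.
  have hginj : Function.Injective g := fun s t hst => by
    obtain ⟨γ, hγ⟩ := hact s
    have h := congrArg γ hst
    rw [hg, hg, hγ] at h
    have ht := huniq _ h.symm
    refine Subtype.ext (Finset.map_injective (π γ).toEmbedding ?_)
    exact congrArg Subtype.val (hγ.trans ht.symm)
  have hM : mahlerM (g s₀) = ((∏ s, max 1 ‖(g s : ℂ)‖ : ℝ) : ℂ) := by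
    refine mahlerM_eq_prod_orbit hginj ?_ (fun γ => ⟨_, hg γ s₀⟩) fun s => ?_
    · rw [hg₀]
      push_cast
      exact hcint.mul (((hf.isIntegral 2).mul (hf.isIntegral 3)).pow N)
    · obtain ⟨γ, hγ⟩ := hact s
      exact ⟨γ⁻¹, by rw [← hγ, ← hg]; exact γ.symm_apply_apply _⟩
  rw [← hg₀, hM]
  congr 1
  calc ∏ s, max 1 ‖(g s : ℂ)‖
      = ∏ s : {s : Finset (ZMod 5) // s.card = 2}, max 1 (∏ i ∈ s.1, ‖(f i : ℂ)‖) ^ N :=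
        Finset.prod_congr rfl fun s _ => by
          rw [hnorm, max_one_pow (Finset.prod_nonneg fun i _ => norm_nonneg _)]
    _ = _ := by
        rw [Finset.prod_pow, ha.prod_pairs_max_one, ← pow_mul]
        simp

theorem IsConjFamily.isWandering_of_pair_transitive [Normal ℚ E] (hf : IsConjFamily π f)
    {ρ : E ≃ₐ[ℚ] E} (hρ : ∀ i, π ρ i = i + 1)
    (htrans : ∀ s : Finset (ZMod 5), s.card = 2 → ∃ γ, s.map (π γ).toEmbedding = {2, 3})
    (ha : HasTwoDominant fun i => ‖(f i : ℂ)‖) (i : ZMod 5) : IsWandering (f i) := by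
  set β : E := f 2 * f 3 with hβ
  have hβ1 : 1 < ‖(β : ℂ)‖ := by
    simpa [hβ] using one_lt_mul_of_lt_of_le ha.one_lt_two ha.one_lt_three.le
  have hreal : (starRingEnd ℂ) (β : ℂ) = β := by
    obtain ⟨γ, hγ, hγnorm⟩ := hf.exists_conj
    have h2 : π γ 2 = 2 ∨ π γ 2 = 3 :=
      (ha.isLargeOppositeTo.one_lt_iff _).1 (by rw [hγnorm]; exact ha.one_lt_two)
    have h3 : π γ 3 = 2 ∨ π γ 3 = 3 :=
      (ha.isLargeOppositeTo.one_lt_iff _).1 (by rw [hγnorm]; exact ha.one_lt_three)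
    have hne : π γ 2 ≠ π γ 3 := (π γ).injective.ne (by decide)
    rw [← hγ, hβ, map_mul, hf.map_apply, hf.map_apply]
    rcases h2 with h2 | h2 <;> rcases h3 with h3 | h3
    · exact absurd (h2.trans h3.symm) hne
    · rw [h2, h3]
    · rw [h2, h3, mul_comm]
    · exact absurd (h2.trans h3.symm) hne
  have hβnorm := ofReal_norm_eq_or_eq_neg hreal
  have hstart : mahlerM (f i) = ((‖(β : ℂ)‖ : ℝ) : ℂ) := by
    have hne : ‖(f 2 : ℂ)‖ ≠ ‖(f 0 : ℂ)‖ :=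
      ((ha.lt_one 0 (by decide) (by decide)).trans ha.one_lt_two).ne'
    rw [hf.mahlerM_apply hρ hne, ha.isLargeOppositeTo.prod_max_one]
    simp only [hβ, MulMemClass.coe_mul, norm_mul]
    rfl
  -- The sign `c` covers a negative `β` at the start; afterwards the exponent `2 * N` is even and
  -- the sign disappears.
  refine IsWandering.of_mahlerM (isWandering_of_invariant
    (P := fun x => ∃ N : ℕ, N ≠ 0 ∧ ∃ c : E, (c = 1 ∨ c = -1) ∧ x = (c * β ^ N : E)) ?_ ?_)
  · rintro _ ⟨N, hN, c, hc, rfl⟩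
    rw [hf.mahlerM_pair_pow htrans ha hc hN, ← hβ]
    refine ⟨⟨2 * N, by omega, 1, Or.inl rfl, ?_⟩, ?_⟩
    · rw [pow_mul, Complex.ofReal_pow, Complex.ofReal_pow, one_mul, pow_mul]
      push_cast
      rcases hβnorm with h | h
      · rw [h]
      · rw [h, neg_sq]
    · have hcnorm : ‖(c : ℂ)‖ = 1 := by rcases hc with rfl | rfl <;> simp
      rw [Complex.norm_real, Real.norm_of_nonneg (by positivity)]
      push_cast
      rw [norm_mul, hcnorm, one_mul, norm_pow]
      exact pow_lt_pow_right₀ hβ1 (by omega)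
  · rw [hstart]
    rcases hβnorm with h | h
    · exact ⟨1, one_ne_zero, 1, Or.inl rfl, by simpa using h⟩
    · exact ⟨1, one_ne_zero, -1, Or.inr rfl, by simpa using h⟩

/-- A group containing the rotations of a pentagon and sending some side to a diagonal is
transitive on pairs. -/
theorem pair_transitive_of_not_adjacent {ρ : E ≃ₐ[ℚ] E} (hρ : ∀ i, π ρ i = i + 1)
    {δ : E ≃ₐ[ℚ] E} {k : ZMod 5} (h₁ : π δ (k + 1) ≠ π δ k + 1) (h₂ : π δ (k + 1) ≠ π δ k - 1)
    (s : Finset (ZMod 5)) (hs : s.card = 2) : ∃ γ, s.map (π γ).toEmbedding = {2, 3} := by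
  have hside : ∀ i, ∃ γ, π γ i = 2 ∧ π γ (i + 1) = 3 := fun i => by
    obtain ⟨γ, hγ⟩ := IsConjFamily.exists_rotation hρ (2 - i)
    refine ⟨γ, by rw [hγ]; ring, ?_⟩
    rw [hγ]; clear * -; revert i; decide
  -- Pull the diagonal `δ (k, k + 1)` back to a side by `δ⁻¹`, then rotate that side to `(2, 3)`.
  have hback : ∀ i j, (∃ m, π m i = π δ k ∧ π m j = π δ (k + 1)) →
      ∃ γ, π γ i = 2 ∧ π γ j = 3 := by
    rintro i j ⟨m, hi, hj⟩
    obtain ⟨γ, h2, h3⟩ := hside k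
    refine ⟨γ * δ⁻¹ * m, ?_, ?_⟩ <;> simp only [map_mul, map_inv, Equiv.Perm.mul_apply]
    · rw [hi, Equiv.Perm.inv_def, Equiv.symm_apply_apply, h2]
    · rw [hj, Equiv.Perm.inv_def, Equiv.symm_apply_apply, h3]
  have hdiag : ∀ i, (∃ γ, π γ i = 2 ∧ π γ (i + 2) = 3) ∨ (∃ γ, π γ (i + 2) = 2 ∧ π γ i = 3) := by
    intro i
    have hne : π δ (k + 1) ≠ π δ k := (π δ).injective.ne (by clear * -; revert k; decide)
    have hcases : π δ (k + 1) = π δ k + 2 ∨ π δ k = π δ (k + 1) + 2 := by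
      generalize π δ (k + 1) = x at *
      generalize π δ k = y at *
      clear * - h₁ h₂ hne
      revert x y
      decide
    rcases hcases with h | h
    · obtain ⟨m, hm⟩ := IsConjFamily.exists_rotation hρ (π δ k - i)
      exact Or.inl (hback _ _ ⟨m, by rw [hm]; ring, by rw [hm, h]; ring⟩)
    · obtain ⟨m, hm⟩ := IsConjFamily.exists_rotation hρ (π δ (k + 1) - i)
      exact Or.inr (hback _ _ ⟨m, by rw [hm, h]; ring, by rw [hm]; ring⟩)
  have hmap : ∀ i j, (∃ γ, π γ i = 2 ∧ π γ j = 3) →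
      ∃ γ, ({i, j} : Finset (ZMod 5)).map (π γ).toEmbedding = {2, 3} := by
    rintro i j ⟨γ, hi, hj⟩
    exact ⟨γ, by simp [Finset.map_insert, hi, hj]⟩
  obtain ⟨i, j, hij, rfl⟩ := Finset.card_eq_two.mp hs
  have hcases : j = i + 1 ∨ i = j + 1 ∨ j = i + 2 ∨ i = j + 2 := by
    clear * - hij
    revert i j
    decide
  rcases hcases with rfl | rfl | rfl | rfl
  · exact hmap _ _ (hside i)
  · rw [Finset.pair_comm]; exact hmap _ _ (hside j)
  · rcases hdiag i with h | h
    · exact hmap _ _ h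
    · rw [Finset.pair_comm]; exact hmap _ _ h
  · rcases hdiag j with h | h
    · rw [Finset.pair_comm]; exact hmap _ _ h
    · exact hmap _ _ h

/-- The five conjugates of a unit with two dominant conjugates at adjacent labels wander. -/
theorem IsConjFamily.isWandering [Normal ℚ E] (hf : IsConjFamily π f)
    {ρ : E ≃ₐ[ℚ] E} (hρ : ∀ i, π ρ i = i + 1)
    (ha : HasTwoDominant fun i => ‖(f i : ℂ)‖) (i : ZMod 5) : IsWandering (f i) := by
  -- The dichotomy is whether the Galois image lies in the dihedral group of the pentagon.
  by_cases hadj : ∀ γ k, π γ (k + 1) = π γ k + 1 ∨ π γ (k + 1) = π γ k - 1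
  · exact isWandering_of_invariant (P := IsPentagonal π)
      (fun x hx => hx.mahlerM_and_norm_lt hρ fun γ => preservesOpposite_of_adjacent (hadj γ))
      ⟨f, hf, ⟨i, rfl⟩, 0, Or.inl ha.isLargeOppositeTo⟩
  · push Not at hadj
    obtain ⟨δ, k, h₁, h₂⟩ := hadj
    exact hf.isWandering_of_pair_transitive hρ
      (fun s hs => pair_transitive_of_not_adjacent hρ h₁ h₂ s hs) ha i

end Pairs

/-! ### The Galois action on embeddings, and conclusion -/

section Embeddings

variable {K : Type*} [Field K] [NumberField K]

/-- A normal extension acts transitively on the embeddings of a number field into it. -/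
theorem exists_algEquiv_comp_eq {E : Type*} [Field E] [Algebra ℚ E] [Normal ℚ E]
    (φ ψ : K →ₐ[ℚ] E) : ∃ γ : E ≃ₐ[ℚ] E, (γ : E →ₐ[ℚ] E).comp φ = ψ := by
  obtain ⟨θ, hθ⟩ := Field.exists_primitive_element ℚ K
  have hint : IsIntegral ℚ θ := IsIntegral.of_finite ℚ θ
  have hconj : IsConjRoot ℚ (φ θ) (ψ θ) := by
    rw [IsConjRoot, minpoly.algHom_eq φ φ.injective, minpoly.algHom_eq ψ ψ.injective]
  obtain ⟨γ, hγ⟩ := isConjRoot_iff_exists_algEquiv.mp hconj.symm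
  refine ⟨γ, AlgHom.ext_of_adjoin_eq_top (s := {θ}) ?_ ?_⟩
  · rw [← IntermediateField.adjoin_simple_toSubalgebra_of_isAlgebraic hint.isAlgebraic, hθ,
      IntermediateField.top_toSubalgebra]
  · intro x hx
    rw [Set.mem_singleton_iff.mp hx]
    exact hγ

end Embeddings

theorem mainTheorem2 (K : Type*) [Field K] [NumberField K] (hK : Module.finrank ℚ K = 5) :
    ∃ u : (NumberField.RingOfIntegers K)ˣ, ∀ φ : K →+* ℂ,
      IsWandering (φ ((u : NumberField.RingOfIntegers K) : K)) := by
  classical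
  obtain ⟨u, a, b, hab, ha, hb, hc⟩ := exists_unit_two_dominant hK
  -- This field is normal and algebraically closed, so it receives all five embeddings, and every
  -- complex embedding of `K` factors through it.
  set E := algebraicClosure ℚ ℂ
  have : IsAlgClosure ℚ E := algebraicClosure.isAlgClosure ℚ ℂ
  have : IsAlgClosed E := IsAlgClosure.isAlgClosed ℚ
  let lift : (K →+* ℂ) → (K →ₐ[ℚ] E) := fun φ =>
    (RingHom.toRatAlgHom φ).codRestrict E.toSubalgebra fun x =>
      mem_algebraicClosure_iff.2 ((Algebra.IsAlgebraic.isAlgebraic (R := ℚ) x).algHom _)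
  have hlift : ∀ φ x, ((lift φ x : E) : ℂ) = φ x := fun φ x => rfl
  let proj : (K →ₐ[ℚ] E) → (K →+* ℂ) := fun c => (E.val.comp c : K →+* ℂ)
  have hproj : ∀ c x, proj c x = (c x : ℂ) := fun c x => rfl
  have hlp : ∀ c, lift (proj c) = c := fun c => rfl
  let _ : MulAction (E ≃ₐ[ℚ] E) (K →ₐ[ℚ] E) :=
    { smul := fun γ c => (γ : E →ₐ[ℚ] E).comp c
      one_smul := fun c => rfl
      mul_smul := fun γ δ c => rfl }
  have hsmul : ∀ (γ : E ≃ₐ[ℚ] E) (c : K →ₐ[ℚ] E) x, (γ • c) x = γ (c x) := fun _ _ _ => rfl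
  have : MulAction.IsPretransitive (E ≃ₐ[ℚ] E) (K →ₐ[ℚ] E) := ⟨exists_algEquiv_comp_eq⟩
  have hcard : Fintype.card (K →ₐ[ℚ] E) = 5 := by rw [AlgHom.card, hK]
  obtain ⟨ρ, e, he2, he3, hρ⟩ := exists_pentagon_labelling (Γ := E ≃ₐ[ℚ] E) hcard
    (a := lift a) (b := lift b) fun h => hab (RingHom.ext fun x => by rw [← hlift, h, hlift])
  let π : (E ≃ₐ[ℚ] E) →* Equiv.Perm (ZMod 5) :=
    (e.symm.permCongrHom : _ →* _).comp (MulAction.toPermHom (E ≃ₐ[ℚ] E) (K →ₐ[ℚ] E))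
  have hπ : ∀ γ i, e (π γ i) = γ • e i := fun γ i => by simp [π]
  have hint : ∀ i (v : (NumberField.RingOfIntegers K)ˣ), IsIntegral ℤ (e i (v : K) : ℂ) :=
    fun i v => map_isIntegral_int (proj (e i)) (NumberField.RingOfIntegers.isIntegral_coe _)
  have hf : IsConjFamily π fun i => e i (u : K) := by
    constructor
    · intro γ i; rw [hπ, hsmul]
    · exact fun i => hint i u
    · intro i
      have h := hint i u⁻¹
      rwa [← zpow_neg_one, NumberField.Units.coe_zpow, zpow_neg_one, map_inv₀] at h
    -- The product of the conjugates is the field norm of a unit, which is `±1`.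
    · rw [Equiv.prod_comp e fun c => ‖(c (u : K) : ℂ)‖, ← norm_prod]
      have h := congrArg (fun x : E => ‖(x : ℂ)‖) (Algebra.norm_eq_prod_embeddings ℚ E (u : K))
      have hu : ‖((Algebra.norm ℚ (u : K) : ℚ) : ℂ)‖ = 1 := by
        rw [Complex.norm_ratCast, ← Rat.cast_abs, NumberField.Units.norm, Rat.cast_one]
      refine Eq.trans ?_ hu
      simpa using h.symm
  refine ⟨u, fun φ => ?_⟩
  obtain ⟨i, hi⟩ := e.surjective (lift φ)
  rw [← hlift, ← hi]
  have h2 : ‖(e 2 (u : K) : ℂ)‖ = ‖a (u : K)‖ := by rw [he2, hlift]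
  have h3 : ‖(e 3 (u : K) : ℂ)‖ = ‖b (u : K)‖ := by rw [he3, hlift]
  have hother : ∀ k, k ≠ 2 → k ≠ 3 → proj (e k) ≠ a ∧ proj (e k) ≠ b := fun k hk2 hk3 =>
    ⟨fun h => hk2 (e.injective (by rw [he2, ← h, hlp])),
      fun h => hk3 (e.injective (by rw [he3, ← h, hlp]))⟩
  refine hf.isWandering (ρ := ρ) (fun k => e.injective (by rw [hπ, hρ]))
    ⟨hf.norm_pos, hf.norm_prod, h2 ▸ ha, h3 ▸ hb, fun k hk2 hk3 => ?_, fun k hk2 hk3 => ?_,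
      fun k hk2 hk3 => ?_⟩ i
  all_goals
    obtain ⟨hka, hkb⟩ := hother k hk2 hk3
    have h := hc _ hka hkb
    simp only [hproj] at h
  · exact h.1
  · simp only [h2]; exact h.2.1
  · simp only [h3]; exact h.2.2
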